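/- Matrices are complex, $\circ$ is the entrywise product, and for a matrix $M$ with no zero entry $M^{(-)}$ is its entrywise inverse; $M^{(-)T}$ is the transpose of $M^{(-)}$. Definitions. For $m\times m$ matrices $A,B$ let $X_A(M)=AM$ and $\Delta_B(M)=B\circ M$ be the corresponding operators on $m\times m$ matrices. The pair $(A,B)$ is an *invertible Jones pair* if $$X_A\Delta_BX_A=\Delta_BX_A\Delta_B\quad\text{and}\quad X_A\Delta_{B^T}X_A=\Delta_{B^T}X_A\Delta_{B^T},$$ and each of $A$, $B$ is invertible and has no zero entry. An $m\times m$ matrix $W$ with no zero entry is *type II* if $W\,W^{(-)T}=mI$; it is a *spin model with loop variable $\delta$* if $\delta^2=m$, $W$ is type II and, for all $a,b,c$, $$\sum_{x}\frac{W_{a,x}W_{x,b}}{W_{x,c}}=\delta\,\frac{W_{a,b}}{W_{b,c}W_{a,c}} .$$ For a matrix $W$ with no zero entry, the *Nomura algebra* $\mathcal N_W$ is the set of matrices $M$ for which all the vectors $We_i\circ W^{(-)}e_j$ are eigenvectors, and $\Theta_W$ is the map on $\mathcal N_W$ for which $\Theta_W(M)_{i,j}$ is the eigenvalue of $M$ on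 $We_i\circ W^{(-)}e_j$. Theorem. Let $(A,B)$ be an invertible Jones pair of $n\times n$ matrices with $A$ symmetric, and let $d\in\mathbb C$ with $d^2=n$. Put $$V=\begin{pmatrix} dA&-dA&B^{(-)}&B^{(-)}\\-dA&dA&B^{(-)}&B^{(-)}\\B^{(-)T}&B^{(-)T}&dA&-dA\\B^{(-)T}&B^{(-)T}&-dA&dA\end{pmatrix},\quad V'=\begin{pmatrix} dA&-dA&-B^{(-)}&-B^{(-)}\\-dA&dA&-B^{(-)}&-B^{(-)}\\-B^{(-)T}&-B^{(-)T}&dA&-dA\\-B^{(-)T}&-B^{(-)T}&-dA&dA\end{pmatrix}.$$ Then $V'=DVD$ with $D=\operatorname{diag}(I_{2n},-I_{2n})$, and $V'$ is a symmetric spin model with loop variable $-2d$. Moreover $\Theta_{V'}=\Theta_V$, that is, $\mathcal N_{V'}=\mathcal N_V$ and $\Theta_{V'}(M)=\Theta_V(M)$ for every $M$ in this algebra. -/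

import Mathlib

open scoped Matrix

namespace JonesPair

variable {ι : Type*} [Fintype ι] [DecidableEq ι]

/-- The operator `X_A : M ↦ A M` on the space of matrices. -/
def opX (A : Matrix ι ι ℂ) : Module.End ℂ (Matrix ι ι ℂ) where
  toFun M := A * M
  map_add' M N := Matrix.mul_add A M N
  map_smul' c M := Matrix.mul_smul A c M

/-- The operator `Δ_B : M ↦ B ∘ M` (entrywise product) on the space of matrices. -/
def opDelta (B : Matrix ι ι ℂ) : Module.End ℂ (Matrix ι ι ℂ) where
  toFun M := B ⊙ M
  map_add' M N := Matrix.hadamard_add B M N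
  map_smul' c M := Matrix.hadamard_smul B M c

/-- The braid relation `X_A Δ_B X_A = Δ_B X_A Δ_B`. -/
def BraidRelation (A B : Matrix ι ι ℂ) : Prop :=
  opX A * opDelta B * opX A = opDelta B * opX A * opDelta B

/-- All entries are nonzero, i.e. the matrix is invertible for the entrywise product. -/
def IsSchurInvertible {κ : Type*} (M : Matrix κ κ ℂ) : Prop :=
  ∀ i j, M i j ≠ 0

/-- The entrywise inverse `M^(-)`. -/
noncomputable def schurInv {κ : Type*} (M : Matrix κ κ ℂ) : Matrix κ κ ℂ :=
  M.map fun x => x⁻¹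

/-- `(A, B)` is an invertible Jones pair: `(A, B)` and `(A, Bᵀ)` both satisfy the braid relation,
and both matrices are invertible for the ordinary and for the entrywise product. -/
structure IsInvertibleJonesPair (A B : Matrix ι ι ℂ) : Prop where
  braid : BraidRelation A B
  braid_transpose : BraidRelation A Bᵀ
  isUnit_left : IsUnit A
  schur_left : IsSchurInvertible A
  isUnit_right : IsUnit B
  schur_right : IsSchurInvertible B

/-- Type-II matrices: `W (W^(-))ᵀ = |ι| I`, with all entries of `W` nonzero. -/
structure IsTypeII (W : Matrix ι ι ℂ) : Prop where
  schur : IsSchurInvertible W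
  mul_eq : W * (schurInv W)ᵀ = (Fintype.card ι : ℂ) • (1 : Matrix ι ι ℂ)

/-- `W` is a spin model with loop variable `δ`: `δ ^ 2` is the size of `W`, `W` is type II, and
the star-triangle relation holds. -/
structure IsSpinModel (W : Matrix ι ι ℂ) (δ : ℂ) : Prop where
  sq_loop : δ ^ 2 = (Fintype.card ι : ℂ)
  typeII : IsTypeII W
  star_triangle : ∀ a b c,
    ∑ x, W a x * W x b / W x c = δ * (W a b / (W b c * W a c))

/-- The vector `W e_i ∘ W^(-) e_j`. -/
noncomputable def evec {κ : Type*} (W : Matrix κ κ ℂ) (i j : κ) : κ → ℂ :=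
  fun x => W x i * schurInv W x j

/-- The Nomura algebra of `W`: the matrices having every `W e_i ∘ W^(-) e_j` as eigenvector. -/
def nomura (W : Matrix ι ι ℂ) : Subalgebra ℂ (Matrix ι ι ℂ) where
  carrier := {M | ∀ i j, ∃ c : ℂ, M *ᵥ evec W i j = c • evec W i j}
  mul_mem' := by
    intro M N hM hN i j
    obtain ⟨a, ha⟩ := hM i j
    obtain ⟨b, hb⟩ := hN i j
    exact ⟨b * a, by rw [← Matrix.mulVec_mulVec, hb, Matrix.mulVec_smul, ha, smul_smul]⟩
  add_mem' := by
    intro M N hM hN i j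
    obtain ⟨a, ha⟩ := hM i j
    obtain ⟨b, hb⟩ := hN i j
    exact ⟨a + b, by rw [Matrix.add_mulVec, ha, hb, add_smul]⟩
  algebraMap_mem' := by
    intro r i j
    exact ⟨r, by rw [Algebra.algebraMap_eq_smul_one, Matrix.smul_mulVec, Matrix.one_mulVec]⟩

/-- The duality map `Θ_W`, defined on the Nomura algebra of `W`: the `(i, j)` entry of `Θ_W(M)` is
the eigenvalue of `M` on `W e_i ∘ W^(-) e_j`. It is unique when `W` has no zero entry, the vector
being then nonzero. -/
noncomputable def theta (W : Matrix ι ι ℂ) (M : Matrix ι ι ℂ) (hM : M ∈ nomura W) :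
    Matrix ι ι ℂ :=
  Matrix.of fun i j => Classical.choose (hM i j)

theorem theta_spec (W M : Matrix ι ι ℂ) (hM : M ∈ nomura W) (i j : ι) :
    M *ᵥ evec W i j = theta W M hM i j • evec W i j :=
  Classical.choose_spec (hM i j)

theorem theta_unique (W M : Matrix ι ι ℂ) (hW : IsSchurInvertible W) (hM : M ∈ nomura W)
    (i j : ι) (c : ℂ) (hc : M *ᵥ evec W i j = c • evec W i j) : theta W M hM i j = c := by
  have h := congrFun ((theta_spec W M hM i j).symm.trans hc) i
  have h0 : evec W i j i ≠ 0 := mul_ne_zero (hW i i) (inv_ne_zero (hW i j))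
  exact mul_right_cancel₀ h0 h

/-- Index set of the four groups of rows and columns: size `4 |ι|`. -/
abbrev Four (ι : Type*) : Type _ := (ι ⊕ ι) ⊕ (ι ⊕ ι)

/-- The `2 × 2` block matrix all of whose blocks are `M`. -/
def blockSame {κ : Type*} (M : Matrix κ κ ℂ) : Matrix (κ ⊕ κ) (κ ⊕ κ) ℂ :=
  Matrix.fromBlocks M M M M

/-- The `2 × 2` block matrix with `M` on the diagonal and `-M` off the diagonal. -/
def blockAlt {κ : Type*} (M : Matrix κ κ ℂ) : Matrix (κ ⊕ κ) (κ ⊕ κ) ℂ :=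
  Matrix.fromBlocks M (-M) (-M) M

/-- The matrix `V` built from `A`, `B` and `d`. -/
noncomputable def matV {κ : Type*} (A B : Matrix κ κ ℂ) (d : ℂ) :
    Matrix (Four κ) (Four κ) ℂ :=
  Matrix.fromBlocks
    (blockAlt (d • A)) (blockSame (schurInv B))
    (blockSame (schurInv B)ᵀ) (blockAlt (d • A))

/-- The matrix `V'` built from `A`, `B` and `d`. -/
noncomputable def matV' {κ : Type*} (A B : Matrix κ κ ℂ) (d : ℂ) :
    Matrix (Four κ) (Four κ) ℂ :=
  Matrix.fromBlocks
    (blockAlt (d • A)) (blockSame (-schurInv B))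
    (blockSame (-(schurInv B)ᵀ)) (blockAlt (d • A))

/-- `D = diag(I, -I)` with blocks of half the size. -/
def matD (κ : Type*) [DecidableEq κ] : Matrix (Four κ) (Four κ) ℂ :=
  Matrix.fromBlocks 1 0 0 (-1)

end JonesPair

/-! For a fixed column `c` of `B` let `D_c` be its diagonal matrix. The braid relation reads `A D_c
A = D_c A D_c`, that is, `A D_c A⁻¹ = D_c⁻¹ A D_c`. The entries of this identity and of its inverse,
together with invertibility of `B`, make `A` and `B` type II and give every star-triangle sum needed
(`sum_eq`, `sum_mul_inv_mul_inv`, `sum_inv_mul_inv_mul`).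

An entry of `V'` in a diagonal block is `±d A`, the sign being a product of a row sign and a column
sign; the other blocks carry no such signs. A sum over the two copies of a position therefore
vanishes if the summand is odd in the sign of `x`, and doubles if it is even. So in each
star-triangle sum only one half of the index set contributes, and it reduces to an identity for `(A,
B)` or `(A, Bᵀ)`.

In `V e_i ∘ V^(-) e_j` conjugation by `D` multiplies entry `x` by the square of a sign, and the
whole vector by a sign. The eigenvectors, hence `Θ`, are unchanged. -/

namespace JonesPair

/-! ### Identities for invertible Jones pairs -/

section Pair

variable {ι : Type*} [Fintype ι] [DecidableEq ι] {A B : Matrix ι ι ℂ}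

theorem BraidRelation.sum_eq (h : BraidRelation A B) (a b c : ι) :
    ∑ x, A a x * A x b * B x c = A a b * B b c * B a c := by
  have h1 := congrFun (congrFun (LinearMap.congr_fun h (Matrix.single b c 1)) a) c
  have h2 : (A * (B ⊙ (A * Matrix.single b c (1 : ℂ)))) a c
      = (B ⊙ (A * (B ⊙ Matrix.single b c (1 : ℂ)))) a c := h1
  simp only [Matrix.mul_apply, Matrix.hadamard_apply, Matrix.single_apply, and_true, mul_ite,
    mul_one, mul_zero, Finset.sum_ite_eq, Finset.mem_univ, if_true] at h2
  calc ∑ x, A a x * A x b * B x c = ∑ x, A a x * (B x c * A x b) :=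
        Finset.sum_congr rfl fun x _ => by ring
    _ = A a b * B b c * B a c := by rw [h2]; ring

/-- Turns facts about columns of `B` into facts about rows, and handles the second half of the
indices of `V'`. -/
theorem IsInvertibleJonesPair.transpose (h : IsInvertibleJonesPair A B) :
    IsInvertibleJonesPair A Bᵀ where
  braid := h.braid_transpose
  braid_transpose := by simpa using h.braid
  isUnit_left := h.isUnit_left
  schur_left := h.schur_left
  isUnit_right := (Matrix.isUnit_transpose B).2 h.isUnit_right
  schur_right := fun i j => h.schur_right j i

/-- Up to the diagonal matrix of a column of `B`, the braid relation is a relation of matrices. -/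
theorem BraidRelation.mul_diagonal_mul (h : BraidRelation A B) (c : ι) :
    A * Matrix.diagonal (fun x => B x c) * A =
      Matrix.diagonal (fun x => B x c) * A * Matrix.diagonal (fun x => B x c) := by
  ext a b
  rw [Matrix.mul_diagonal, Matrix.diagonal_mul, Matrix.mul_apply]
  simp only [Matrix.mul_diagonal]
  calc ∑ x, A a x * B x c * A x b = ∑ x, A a x * A x b * B x c :=
        Finset.sum_congr rfl fun x _ => by ring
    _ = B a c * A a b * B b c := by rw [h.sum_eq]; ring

namespace IsInvertibleJonesPair

variable (h : IsInvertibleJonesPair A B)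

include h

theorem sum_conj (a b c : ι) :
    ∑ x, A a x * B x c * A⁻¹ x b = (B a c)⁻¹ * A a b * B b c := by
  have hA : IsUnit A.det := (Matrix.isUnit_iff_isUnit_det A).1 h.isUnit_left
  have h1 : A * Matrix.diagonal (fun x => B x c) * A⁻¹ =
      Matrix.diagonal (fun x => (B x c)⁻¹) * A * Matrix.diagonal (fun x => B x c) := by
    have h2 : Matrix.diagonal (fun x => (B x c)⁻¹) * Matrix.diagonal (fun x => B x c) = 1 := by
      rw [Matrix.diagonal_mul_diagonal, ← Matrix.diagonal_one]
      congr 1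
      ext x
      exact inv_mul_cancel₀ (h.schur_right x c)
    have h3 := congrArg (Matrix.diagonal (fun x => (B x c)⁻¹) * ·) (h.braid.mul_diagonal_mul c)
    simp only [← Matrix.mul_assoc, h2, Matrix.one_mul] at h3
    rw [← h3, Matrix.mul_nonsing_inv_cancel_right _ _ hA]
  have h4 := congrFun (congrFun h1 a) b
  rw [Matrix.mul_diagonal, Matrix.diagonal_mul, Matrix.mul_apply] at h4
  simpa only [Matrix.mul_diagonal] using h4

/-- Entrywise form of the inverse of the matrix identity behind `sum_conj`. -/
theorem sum_conj_inv (a b c : ι) :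
    ∑ x, A a x * (B x c)⁻¹ * A⁻¹ x b = (B a c)⁻¹ * A⁻¹ a b * B b c := by
  have hA : IsUnit A.det := (Matrix.isUnit_iff_isUnit_det A).1 h.isUnit_left
  set D := Matrix.diagonal (fun x => B x c) with hD
  set E := Matrix.diagonal (fun x => (B x c)⁻¹) with hE
  have hED : E * D = 1 := by
    rw [hD, hE, Matrix.diagonal_mul_diagonal, ← Matrix.diagonal_one]
    congr 1
    ext x
    exact inv_mul_cancel₀ (h.schur_right x c)
  have hDE : D * E = 1 := mul_eq_one_comm.1 hED
  have h1 : A * E * A⁻¹ = E * A⁻¹ * D := by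
    have h2 : A * D * A = D * A * D := h.braid.mul_diagonal_mul c
    have h3 : D * A * E = A⁻¹ * (D * A) := by
      calc D * A * E = A⁻¹ * (A * D * A) * E := by
            rw [Matrix.mul_assoc A, Matrix.nonsing_inv_mul_cancel_left _ _ hA]
        _ = A⁻¹ * (D * A) * (D * E) := by rw [h2]; simp only [Matrix.mul_assoc]
        _ = A⁻¹ * (D * A) := by rw [hDE, Matrix.mul_one]
    calc A * E * A⁻¹ = E * D * A * E * A⁻¹ := by rw [hED, Matrix.one_mul]
      _ = E * (D * A * E) * A⁻¹ := by simp only [Matrix.mul_assoc]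
      _ = E * A⁻¹ * D * (A * A⁻¹) := by rw [h3]; simp only [Matrix.mul_assoc]
      _ = E * A⁻¹ * D := by rw [Matrix.mul_nonsing_inv _ hA, Matrix.mul_one]
  have h4 := congrFun (congrFun h1 a) b
  rw [Matrix.mul_diagonal, Matrix.diagonal_mul, Matrix.mul_apply] at h4
  simpa only [hE, Matrix.mul_diagonal] using h4

/-- Every column of `B` lists the eigenvalues of `A`, so it sums to the trace of `A`. -/
theorem sum_column (c : ι) : ∑ x, B x c = ∑ x, A x x := by
  have hA : IsUnit A.det := (Matrix.isUnit_iff_isUnit_det A).1 h.isUnit_left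
  have h2 : ∀ a, ∑ x, A a x * B x c * A⁻¹ x a = A a a := fun a => by
    rw [h.sum_conj]
    field_simp [h.schur_right a c]
  have h3 : ∀ x, ∑ a, A⁻¹ x a * A a x = 1 := fun x => by
    rw [← Matrix.mul_apply, Matrix.nonsing_inv_mul _ hA, Matrix.one_apply_eq]
  calc ∑ x, B x c = ∑ x, ∑ a, A a x * B x c * A⁻¹ x a := by
        refine Finset.sum_congr rfl fun x _ => ?_
        calc B x c = (∑ a, A⁻¹ x a * A a x) * B x c := by rw [h3, one_mul]
          _ = ∑ a, A a x * B x c * A⁻¹ x a := by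
            rw [Finset.sum_mul]
            exact Finset.sum_congr rfl fun a _ => by ring
    _ = ∑ a, A a a := by
        rw [Finset.sum_comm]
        exact Finset.sum_congr rfl fun a _ => h2 a

theorem sum_row (c : ι) : ∑ x, B c x = ∑ x, A x x := h.transpose.sum_column c

/-- This is the type II property of `A`. By `sum_conj` on the diagonal, the row vector `v y = A a y
* A⁻¹ y a` satisfies `v B = A a a • 1`, while `1 B = t • 1` with `t` the trace of `A`. As `B` is
invertible, `v` is constant, and its entries sum to 1. -/
theorem card_mul_inv_apply (a b : ι) : (Fintype.card ι : ℂ) * A⁻¹ b a = (A a b)⁻¹ := by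
  have hA : IsUnit A.det := (Matrix.isUnit_iff_isUnit_det A).1 h.isUnit_left
  have hinj : Function.Injective fun v => Matrix.vecMul v B :=
    Matrix.vecMul_injective_of_isUnit h.isUnit_right
  set t := ∑ x, A x x with ht
  have hone : Matrix.vecMul (1 : ι → ℂ) B = fun _ => t := by
    ext c
    simp only [Matrix.vecMul, dotProduct, Pi.one_apply, one_mul]
    exact h.sum_column c
  have ht0 : t ≠ 0 := by
    intro h0
    have : (1 : ι → ℂ) = 0 := hinj (by
      simp only [Matrix.zero_vecMul]
      rw [hone, h0]
      rfl)
    exact one_ne_zero (congrFun this a)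
  have hv : (fun y => A a y * A⁻¹ y a) = (A a a / t) • (1 : ι → ℂ) := hinj (by
    simp only [Matrix.smul_vecMul]
    rw [hone]
    ext c
    have h1 := h.sum_conj a a c
    have h2 : (B a c)⁻¹ * A a a * B a c = A a a := by
      field_simp [h.schur_right a c]
    rw [h2] at h1
    simp only [Matrix.vecMul, dotProduct, Pi.smul_apply, smul_eq_mul]
    rw [div_mul_cancel₀ _ ht0, ← h1]
    exact Finset.sum_congr rfl fun x _ => by ring)
  have hv' : ∀ y, A a y * A⁻¹ y a = A a a / t := fun y => by
    simpa using congrFun hv y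
  have hs : ∑ y, A a y * A⁻¹ y a = 1 := by
    rw [← Matrix.mul_apply, Matrix.mul_nonsing_inv _ hA, Matrix.one_apply_eq]
  simp only [hv', Finset.sum_const, Finset.card_univ, nsmul_eq_mul] at hs
  rw [← hv' b] at hs
  exact eq_inv_of_mul_eq_one_left (by linear_combination hs)

theorem sum_div_left (a b : ι) :
    ∑ x, A a x * (A b x)⁻¹ = if a = b then (Fintype.card ι : ℂ) else 0 := by
  have hA : IsUnit A.det := (Matrix.isUnit_iff_isUnit_det A).1 h.isUnit_left
  have h1 : ∑ x, A a x * A⁻¹ x b = (1 : Matrix ι ι ℂ) a b := by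
    rw [← Matrix.mul_apply, Matrix.mul_nonsing_inv _ hA]
  calc ∑ x, A a x * (A b x)⁻¹ = (Fintype.card ι : ℂ) * ∑ x, A a x * A⁻¹ x b := by
        rw [Finset.mul_sum]
        refine Finset.sum_congr rfl fun x _ => ?_
        rw [← h.card_mul_inv_apply b x]
        ring
    _ = _ := by rw [h1, Matrix.one_apply]; split_ifs <;> simp

theorem sum_div_right (a b : ι) :
    ∑ x, (B a x)⁻¹ * B b x = if a = b then (Fintype.card ι : ℂ) else 0 := by
  have hA : IsUnit A.det := (Matrix.isUnit_iff_isUnit_det A).1 h.isUnit_left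
  split_ifs with hab
  · subst hab
    simp [inv_mul_cancel₀ (h.schur_right _ _)]
  -- The factor `A a b` lets `sum_conj` expand each term; the row sums of `B` are then constant and
  -- `A * A⁻¹` kills the rest.
  · refine (mul_eq_zero.1 ?_).resolve_left (h.schur_left a b)
    calc A a b * ∑ x, (B a x)⁻¹ * B b x = ∑ c, ∑ x, A a x * B x c * A⁻¹ x b := by
          rw [Finset.mul_sum]
          refine Finset.sum_congr rfl fun c _ => ?_
          rw [h.sum_conj]
          ring
      _ = ∑ x, (A a x * A⁻¹ x b) * ∑ c, B x c := by
          rw [Finset.sum_comm]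
          refine Finset.sum_congr rfl fun x _ => ?_
          rw [Finset.mul_sum]
          exact Finset.sum_congr rfl fun c _ => by ring
      _ = (∑ x, A a x * A⁻¹ x b) * ∑ x, A x x := by
          simp only [h.sum_row, Finset.sum_mul]
      _ = 0 := by
          rw [← Matrix.mul_apply, Matrix.mul_nonsing_inv _ hA, Matrix.one_apply_ne hab, zero_mul]

/-- The star-triangle relation for one matrix `A` on each side of the quotient. -/
theorem sum_mul_inv_mul_inv (a b c : ι) :
    ∑ x, A a x * (A c x)⁻¹ * (B x b)⁻¹ = B c b * (B a b)⁻¹ * (A c a)⁻¹ := by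
  calc ∑ x, A a x * (A c x)⁻¹ * (B x b)⁻¹
      = (Fintype.card ι : ℂ) * ∑ x, A a x * (B x b)⁻¹ * A⁻¹ x c := by
        rw [Finset.mul_sum]
        refine Finset.sum_congr rfl fun x _ => ?_
        rw [← h.card_mul_inv_apply c x]
        ring
    _ = _ := by
        rw [h.sum_conj_inv, ← h.card_mul_inv_apply c a]
        ring

/-- The star-triangle relation for the rows of `B`. -/
theorem sum_inv_mul_inv_mul (a b c : ι) :
    ∑ x, (B a x)⁻¹ * (B b x)⁻¹ * B c x = A a b * (A a c)⁻¹ * (A c b)⁻¹ := by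
  -- The quotient of two rows of `B` is a combination of rows of `B`; orthogonality then keeps only
  -- `y = b`.
  have h1 : ∀ x, (B a x)⁻¹ * B c x = (A a c)⁻¹ * ∑ y, A a y * B y x * A⁻¹ y c := fun x => by
    rw [h.sum_conj]
    field_simp [h.schur_left a c]
  calc ∑ x, (B a x)⁻¹ * (B b x)⁻¹ * B c x
      = ∑ x, ∑ y, (A a c)⁻¹ * (A a y * A⁻¹ y c) * ((B b x)⁻¹ * B y x) := by
        refine Finset.sum_congr rfl fun x _ => ?_
        rw [mul_right_comm, h1, Finset.mul_sum, Finset.sum_mul]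
        exact Finset.sum_congr rfl fun y _ => by ring
    _ = ∑ y, (A a c)⁻¹ * (A a y * A⁻¹ y c) * ∑ x, (B b x)⁻¹ * B y x := by
        rw [Finset.sum_comm]
        simp only [Finset.mul_sum]
    _ = A a b * (A a c)⁻¹ * (A c b)⁻¹ := by
        simp only [h.sum_div_right, mul_ite, mul_zero, Finset.sum_ite_eq, Finset.mem_univ, if_true]
        rw [← h.card_mul_inv_apply c b]
        ring

end IsInvertibleJonesPair

end Pair

/-! ### Block signs and conjugation by `D` -/

section Blocks

variable {κ : Type*}

/-- The sign of a block: `1` on the first summand and `-1` on the second. -/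
def blockSign : κ ⊕ κ → ℂ := Sum.elim (fun _ => 1) fun _ => -1

/-- The position inside a block. -/
def blockPos : κ ⊕ κ → κ := Sum.elim id id

theorem blockSign_mul_self (x : κ ⊕ κ) : blockSign x * blockSign x = 1 := by
  cases x <;> simp [blockSign]

theorem blockSign_inv (x : κ ⊕ κ) : (blockSign x)⁻¹ = blockSign x := by
  cases x <;> simp [blockSign]

theorem blockSign_ne_zero (x : κ ⊕ κ) : blockSign x ≠ 0 := by
  cases x <;> simp [blockSign]

theorem sum_blockSign_mul [Fintype κ] (f : κ → ℂ) :
    ∑ x : κ ⊕ κ, blockSign x * f (blockPos x) = 0 := by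
  simp [Fintype.sum_sum_type, blockSign, blockPos]

theorem sum_blockPos [Fintype κ] (f : κ → ℂ) :
    ∑ x : κ ⊕ κ, f (blockPos x) = 2 * ∑ x, f x := by
  simp [Fintype.sum_sum_type, blockPos, two_mul]

theorem blockAlt_apply (M : Matrix κ κ ℂ) (a b : κ ⊕ κ) :
    blockAlt M a b = blockSign a * blockSign b * M (blockPos a) (blockPos b) := by
  rcases a with a | a <;> rcases b with b | b <;> simp [blockAlt, blockSign, blockPos]

theorem blockSame_apply (M : Matrix κ κ ℂ) (a b : κ ⊕ κ) :
    blockSame M a b = M (blockPos a) (blockPos b) := by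
  rcases a with a | a <;> rcases b with b | b <;> simp [blockSame, blockPos]

variable (A B : Matrix κ κ ℂ) (d : ℂ)

theorem matV'_inl_inl (a b : κ ⊕ κ) : matV' A B d (.inl a) (.inl b) =
    blockSign a * blockSign b * (d * A (blockPos a) (blockPos b)) := by
  simp [matV', blockAlt_apply]

theorem matV'_inr_inr (a b : κ ⊕ κ) : matV' A B d (.inr a) (.inr b) =
    blockSign a * blockSign b * (d * A (blockPos a) (blockPos b)) := by
  simp [matV', blockAlt_apply]

theorem matV'_inl_inr (a b : κ ⊕ κ) : matV' A B d (.inl a) (.inr b) =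
    -(B (blockPos a) (blockPos b))⁻¹ := by
  simp [matV', blockSame_apply, schurInv]

theorem matV'_inr_inl (a b : κ ⊕ κ) : matV' A B d (.inr a) (.inl b) =
    -(B (blockPos b) (blockPos a))⁻¹ := by
  simp [matV', blockSame_apply, schurInv]

/-- The diagonal of `D`. -/
def signD : Four κ → ℂ := Sum.elim (fun _ => 1) fun _ => -1

theorem signD_mul_self (x : Four κ) : signD x * signD x = 1 := by
  cases x <;> simp [signD]

theorem signD_inv (x : Four κ) : (signD x)⁻¹ = signD x := by
  cases x <;> simp [signD]

theorem matV'_apply (x y : Four κ) :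
    matV' A B d x y = signD x * matV A B d x y * signD y := by
  rcases x with x | x <;> rcases y with y | y <;>
    simp [matV', matV, signD, blockSame_apply]

theorem matD_eq_diagonal [DecidableEq κ] : matD κ = Matrix.diagonal signD := by
  ext x y
  rcases x with x | x <;> rcases y with y | y <;>
    simp [matD, Matrix.diagonal_apply, Matrix.one_apply, signD]
  split_ifs <;> simp

theorem matV'_eq [Fintype κ] [DecidableEq κ] :
    matV' A B d = matD κ * matV A B d * matD κ := by
  ext x y
  rw [matD_eq_diagonal, Matrix.mul_diagonal, Matrix.diagonal_mul, matV'_apply]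

theorem evec_matV' (i j : Four κ) :
    evec (matV' A B d) i j = (signD i * signD j) • evec (matV A B d) i j := by
  ext x
  simp only [evec, schurInv, Matrix.map_apply, matV'_apply, Pi.smul_apply, smul_eq_mul, mul_inv,
    signD_inv]
  linear_combination (signD i * signD j * matV A B d x i * (matV A B d x j)⁻¹) * signD_mul_self x

theorem mulVec_evec_matV'_iff [Fintype κ] (M : Matrix (Four κ) (Four κ) ℂ) (i j : Four κ)
    (c : ℂ) : M *ᵥ evec (matV' A B d) i j = c • evec (matV' A B d) i j ↔
      M *ᵥ evec (matV A B d) i j = c • evec (matV A B d) i j := by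
  have hs : signD i * signD j ≠ 0 := fun h0 => by
    have h1 := signD_mul_self i
    have h2 := signD_mul_self j
    have : (1 : ℂ) = 0 := by
      linear_combination (-signD j * signD j) * h1 - h2 + signD i * signD j * h0
    exact one_ne_zero this
  rw [evec_matV', Matrix.mulVec_smul, smul_comm c]
  exact (smul_right_injective _ hs).eq_iff

theorem nomura_matV' [Fintype κ] [DecidableEq κ] :
    nomura (matV' A B d) = nomura (matV A B d) := by
  ext M
  exact forall_congr' fun i => forall_congr' fun j => exists_congr fun c =>
    mulVec_evec_matV'_iff A B d M i j c

variable {A B d}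

theorem matV'_isSymm (hA : A.IsSymm) : (matV' A B d).IsSymm := by
  ext x y
  rw [Matrix.transpose_apply]
  rcases x with x | x <;> rcases y with y | y <;>
    simp only [matV'_inl_inl, matV'_inl_inr, matV'_inr_inl, matV'_inr_inr,
      hA.apply (blockPos x) (blockPos y), mul_comm (blockSign x)]

theorem matV'_isSchurInvertible (hA : IsSchurInvertible A) (hB : IsSchurInvertible B)
    (hd : d ≠ 0) : IsSchurInvertible (matV' A B d) := by
  intro x y
  rcases x with x | x <;> rcases y with y | y <;>
    simp [matV'_inl_inl, matV'_inl_inr, matV'_inr_inl, matV'_inr_inr, hA _ _, hB _ _, hd,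
      blockSign_ne_zero]

/-- `theta` is a choice of eigenvalue; it is determined because `V'` has no zero entry. -/
theorem theta_matV' [Fintype κ] [DecidableEq κ] (hV : IsSchurInvertible (matV' A B d))
    (M : Matrix (Four κ) (Four κ) ℂ) (h' : M ∈ nomura (matV' A B d))
    (h : M ∈ nomura (matV A B d)) :
    theta (matV' A B d) M h' = theta (matV A B d) M h := by
  ext i j
  exact theta_unique _ _ hV _ _ _ _
    ((mulVec_evec_matV'_iff A B d M i j _).2 (theta_spec _ _ h i j))

end Blocks

/-! ### Type II property and star-triangle relation for `V'` -/

section SpinModel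

theorem ne_zero_of_sq_eq_card {ι : Type*} [Fintype ι] [Nonempty ι] {d : ℂ}
    (hd : d ^ 2 = (Fintype.card ι : ℂ)) : d ≠ 0 := by
  rintro rfl
  have : (Fintype.card ι : ℂ) ≠ 0 := Nat.cast_ne_zero.2 Fintype.card_ne_zero
  exact this (by rw [← hd]; norm_num)

theorem blockSign_combine {ι : Type*} [DecidableEq ι] (a b : ι ⊕ ι) (n : ℂ) :
    (blockSign a * blockSign b + 1) * (2 * if blockPos a = blockPos b then n else 0) =
      if a = b then 4 * n else 0 := by
  rcases a with a | a <;> rcases b with b | b <;> by_cases hab : a = b <;>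
    simp [blockSign, blockPos, hab]
  all_goals ring

variable {ι : Type*} [Fintype ι] [DecidableEq ι] {A B : Matrix ι ι ℂ} {d : ℂ}

theorem IsInvertibleJonesPair.matV'_isTypeII (h : IsInvertibleJonesPair A B) (hd : d ≠ 0) :
    IsTypeII (matV' A B d) where
  schur := matV'_isSchurInvertible h.schur_left h.schur_right hd
  mul_eq := by
    have hcard : (Fintype.card (Four ι) : ℂ) = 4 * Fintype.card ι := by
      simp only [Four, Fintype.card_sum]
      push_cast
      ring
    rw [hcard]
    ext a b
    rw [Matrix.mul_apply, Fintype.sum_sum_type, Matrix.smul_apply, Matrix.one_apply, smul_eq_mul,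
      mul_ite, mul_one, mul_zero]
    simp only [Matrix.transpose_apply, schurInv, Matrix.map_apply]
    have key : ∀ a b : ι ⊕ ι, ∑ x : ι ⊕ ι, blockSign a * blockSign x *
        (d * A (blockPos a) (blockPos x)) *
        (blockSign b * blockSign x * (d * A (blockPos b) (blockPos x)))⁻¹ =
        blockSign a * blockSign b *
          (2 * if blockPos a = blockPos b then (Fintype.card ι : ℂ) else 0) := fun a b => by
      rw [← h.sum_div_left, ← sum_blockPos
        fun x => A (blockPos a) x * (A (blockPos b) x)⁻¹, Finset.mul_sum]
      refine Finset.sum_congr rfl fun x _ => ?_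
      have := h.schur_left (blockPos b) (blockPos x)
      rw [mul_inv, mul_inv, blockSign_inv, blockSign_inv]
      field_simp
      linear_combination (blockSign a * blockSign b * A (blockPos a) (blockPos x)) *
        blockSign_mul_self x
    rcases a with a | a <;> rcases b with b | b <;>
      simp only [matV'_inl_inl, matV'_inl_inr, matV'_inr_inl, matV'_inr_inr, inv_neg, inv_inv,
        neg_mul_neg, Sum.inl.injEq, Sum.inr.injEq, reduceCtorEq, if_false]
    · rw [key, sum_blockPos fun x => (B (blockPos a) x)⁻¹ * B (blockPos b) x, h.sum_div_right,
        ← blockSign_combine]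
      ring
    -- Each half of the sum contains the sign of `x` exactly once, so both vanish.
    · convert add_zero (0 : ℂ) using 2
      · rw [← sum_blockSign_mul fun x =>
          -(blockSign a * (d * A (blockPos a) x) * B x (blockPos b))]
        exact Finset.sum_congr rfl fun x _ => by ring
      · rw [← sum_blockSign_mul fun x =>
          -(blockSign b * (d * A (blockPos b) x)⁻¹ * (B (blockPos a) x)⁻¹)]
        refine Finset.sum_congr rfl fun x _ => ?_
        rw [mul_inv, mul_inv, blockSign_inv, blockSign_inv]
        ring
    · convert add_zero (0 : ℂ) using 2
      · rw [← sum_blockSign_mul fun x =>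
          -(blockSign b * (d * A (blockPos b) x)⁻¹ * (B x (blockPos a))⁻¹)]
        refine Finset.sum_congr rfl fun x _ => ?_
        rw [mul_inv, mul_inv, blockSign_inv, blockSign_inv]
        ring
      · rw [← sum_blockSign_mul fun x =>
          -(blockSign a * (d * A (blockPos a) x) * B (blockPos b) x)]
        exact Finset.sum_congr rfl fun x _ => by ring
    · rw [key, sum_blockPos fun x => (B x (blockPos a))⁻¹ * B x (blockPos b)]
      have := h.transpose.sum_div_right (blockPos a) (blockPos b)
      simp only [Matrix.transpose_apply] at this
      rw [this, ← blockSign_combine]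
      ring

/-- If `a`, `b` and `c` lie in the same half, only the blocks of `B` contribute. -/
theorem IsInvertibleJonesPair.star_same (h : IsInvertibleJonesPair A B) (hA : A.IsSymm)
    (hd : d ≠ 0) (a b c : ι ⊕ ι) :
    (∑ x : ι ⊕ ι, blockSign a * blockSign x * (d * A (blockPos a) (blockPos x)) *
        (blockSign x * blockSign b * (d * A (blockPos x) (blockPos b))) /
        (blockSign x * blockSign c * (d * A (blockPos x) (blockPos c)))) +
      ∑ x : ι ⊕ ι, -(B (blockPos a) (blockPos x))⁻¹ * -(B (blockPos b) (blockPos x))⁻¹ /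
        -(B (blockPos c) (blockPos x))⁻¹ =
    -2 * d * (blockSign a * blockSign b * (d * A (blockPos a) (blockPos b)) /
      (blockSign b * blockSign c * (d * A (blockPos b) (blockPos c)) *
        (blockSign a * blockSign c * (d * A (blockPos a) (blockPos c))))) := by
  have h1 : ∑ x : ι ⊕ ι, blockSign a * blockSign x * (d * A (blockPos a) (blockPos x)) *
        (blockSign x * blockSign b * (d * A (blockPos x) (blockPos b))) /
        (blockSign x * blockSign c * (d * A (blockPos x) (blockPos c))) = 0 := by
    rw [← sum_blockSign_mul fun x => blockSign a * blockSign b * blockSign c *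
      (d * A (blockPos a) x) * (d * A x (blockPos b)) * (d * A x (blockPos c))⁻¹]
    refine Finset.sum_congr rfl fun x _ => ?_
    rw [div_eq_mul_inv, mul_inv, mul_inv, blockSign_inv, blockSign_inv]
    linear_combination (blockSign x * blockSign a * blockSign b * blockSign c *
      (d * A (blockPos a) (blockPos x)) * (d * A (blockPos x) (blockPos b)) *
      (d * A (blockPos x) (blockPos c))⁻¹) * blockSign_mul_self x
  -- Three minus signs from `-B^(-)` leave one: hence the loop variable `-2 * d`.
  have h2 : ∑ x : ι ⊕ ι, -(B (blockPos a) (blockPos x))⁻¹ * -(B (blockPos b) (blockPos x))⁻¹ /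
        -(B (blockPos c) (blockPos x))⁻¹ =
      -(2 * (A (blockPos a) (blockPos b) * (A (blockPos a) (blockPos c))⁻¹ *
        (A (blockPos c) (blockPos b))⁻¹)) := by
    rw [← h.sum_inv_mul_inv_mul, ← sum_blockPos fun x =>
      (B (blockPos a) x)⁻¹ * (B (blockPos b) x)⁻¹ * B (blockPos c) x, ← Finset.sum_neg_distrib]
    refine Finset.sum_congr rfl fun x _ => ?_
    rw [div_eq_mul_inv, inv_neg, inv_inv]
    ring
  rw [h1, h2, hA.apply (blockPos b) (blockPos c)]
  have e1 := h.schur_left (blockPos b) (blockPos c)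
  have e2 := h.schur_left (blockPos a) (blockPos c)
  have s1 := blockSign_ne_zero a
  have s2 := blockSign_ne_zero b
  have s3 := blockSign_ne_zero c
  field_simp
  linear_combination (-2 * A (blockPos a) (blockPos b)) * blockSign_mul_self c

/-- The case where `a` and `b` lie in one half and `c` in the other one. -/
theorem IsInvertibleJonesPair.star_left (h : IsInvertibleJonesPair A B)
    (a b c : ι ⊕ ι) :
    (∑ x : ι ⊕ ι, blockSign a * blockSign x * (d * A (blockPos a) (blockPos x)) *
        (blockSign x * blockSign b * (d * A (blockPos x) (blockPos b))) /
        -(B (blockPos x) (blockPos c))⁻¹) +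
      ∑ x : ι ⊕ ι, -(B (blockPos a) (blockPos x))⁻¹ * -(B (blockPos b) (blockPos x))⁻¹ /
        (blockSign x * blockSign c * (d * A (blockPos x) (blockPos c))) =
    -2 * d * (blockSign a * blockSign b * (d * A (blockPos a) (blockPos b)) /
      (-(B (blockPos b) (blockPos c))⁻¹ * -(B (blockPos a) (blockPos c))⁻¹)) := by
  have h1 : ∑ x : ι ⊕ ι, -(B (blockPos a) (blockPos x))⁻¹ * -(B (blockPos b) (blockPos x))⁻¹ /
        (blockSign x * blockSign c * (d * A (blockPos x) (blockPos c))) = 0 := by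
    rw [← sum_blockSign_mul fun x => (B (blockPos a) x)⁻¹ * (B (blockPos b) x)⁻¹ *
      (blockSign c * (d * A x (blockPos c))⁻¹)]
    refine Finset.sum_congr rfl fun x _ => ?_
    rw [div_eq_mul_inv, mul_inv, mul_inv, blockSign_inv, blockSign_inv]
    ring
  have h2 : ∑ x : ι ⊕ ι, blockSign a * blockSign x * (d * A (blockPos a) (blockPos x)) *
        (blockSign x * blockSign b * (d * A (blockPos x) (blockPos b))) /
        -(B (blockPos x) (blockPos c))⁻¹ =
      -(blockSign a * blockSign b * d ^ 2) * (2 * (A (blockPos a) (blockPos b) *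
        B (blockPos b) (blockPos c) * B (blockPos a) (blockPos c))) := by
    rw [← h.braid.sum_eq, ← sum_blockPos fun x =>
      A (blockPos a) x * A x (blockPos b) * B x (blockPos c), Finset.mul_sum]
    refine Finset.sum_congr rfl fun x _ => ?_
    rw [div_eq_mul_inv, inv_neg, inv_inv]
    linear_combination (-(blockSign a * blockSign b * d ^ 2) * (A (blockPos a) (blockPos x) *
      A (blockPos x) (blockPos b) * B (blockPos x) (blockPos c))) * blockSign_mul_self x
  rw [h1, h2, div_eq_mul_inv, mul_inv, inv_neg, inv_neg, inv_inv, inv_inv]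
  ring

/-- The case where `a` and `c` lie in one half and `b` in the other one. -/
theorem IsInvertibleJonesPair.star_right (h : IsInvertibleJonesPair A B) (hA : A.IsSymm)
    (hd : d ≠ 0) (a b c : ι ⊕ ι) :
    (∑ x : ι ⊕ ι, blockSign a * blockSign x * (d * A (blockPos a) (blockPos x)) *
        -(B (blockPos x) (blockPos b))⁻¹ /
        (blockSign x * blockSign c * (d * A (blockPos x) (blockPos c)))) +
      ∑ x : ι ⊕ ι, -(B (blockPos a) (blockPos x))⁻¹ *
        (blockSign x * blockSign b * (d * A (blockPos x) (blockPos b))) /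
        -(B (blockPos c) (blockPos x))⁻¹ =
    -2 * d * (-(B (blockPos a) (blockPos b))⁻¹ /
      (-(B (blockPos c) (blockPos b))⁻¹ *
        (blockSign a * blockSign c * (d * A (blockPos a) (blockPos c))))) := by
  have h1 : ∑ x : ι ⊕ ι, -(B (blockPos a) (blockPos x))⁻¹ *
        (blockSign x * blockSign b * (d * A (blockPos x) (blockPos b))) /
        -(B (blockPos c) (blockPos x))⁻¹ = 0 := by
    rw [← sum_blockSign_mul fun x => (B (blockPos a) x)⁻¹ *
      (blockSign b * (d * A x (blockPos b))) * B (blockPos c) x]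
    refine Finset.sum_congr rfl fun x _ => ?_
    rw [div_eq_mul_inv, inv_neg, inv_inv]
    ring
  have h2 : ∑ x : ι ⊕ ι, blockSign a * blockSign x * (d * A (blockPos a) (blockPos x)) *
        -(B (blockPos x) (blockPos b))⁻¹ /
        (blockSign x * blockSign c * (d * A (blockPos x) (blockPos c))) =
      -(blockSign a * blockSign c) * (2 * (B (blockPos c) (blockPos b) *
        (B (blockPos a) (blockPos b))⁻¹ * (A (blockPos c) (blockPos a))⁻¹)) := by
    rw [← h.sum_mul_inv_mul_inv, ← sum_blockPos fun x =>
      A (blockPos a) x * (A (blockPos c) x)⁻¹ * (B x (blockPos b))⁻¹, Finset.mul_sum]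
    refine Finset.sum_congr rfl fun x _ => ?_
    rw [div_eq_mul_inv, mul_inv, mul_inv, blockSign_inv, blockSign_inv,
      hA.apply (blockPos c) (blockPos x), mul_inv]
    linear_combination (-(blockSign a * blockSign c) * (A (blockPos a) (blockPos x) *
      (A (blockPos c) (blockPos x))⁻¹ * (B (blockPos x) (blockPos b))⁻¹)) *
        (d * d⁻¹ * blockSign_mul_self x + mul_inv_cancel₀ hd)
  rw [h1, h2, hA.apply (blockPos a) (blockPos c), div_eq_mul_inv, mul_inv, inv_neg, inv_inv,
    mul_inv, mul_inv, mul_inv, blockSign_inv, blockSign_inv]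
  linear_combination (2 * blockSign a * blockSign c * B (blockPos c) (blockPos b) *
    (B (blockPos a) (blockPos b))⁻¹ * (A (blockPos a) (blockPos c))⁻¹) * mul_inv_cancel₀ hd

theorem IsInvertibleJonesPair.matV'_isSpinModel (h : IsInvertibleJonesPair A B) (hA : A.IsSymm)
    (hd : d ^ 2 = (Fintype.card ι : ℂ)) : IsSpinModel (matV' A B d) (-2 * d) := by
  have hsq : (-2 * d) ^ 2 = (Fintype.card (Four ι) : ℂ) := by
    simp only [Four, Fintype.card_sum]
    push_cast
    rw [← hd]
    ring
  -- The empty case is apart because there `d = 0`.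
  rcases isEmpty_or_nonempty ι with hι | hι
  · exact ⟨hsq, ⟨fun i => isEmptyElim i, by ext i; exact isEmptyElim i⟩,
      fun i => isEmptyElim i⟩
  have hd0 : d ≠ 0 := ne_zero_of_sq_eq_card hd
  refine ⟨hsq, h.matV'_isTypeII hd0, ?_⟩
  have hlr : ∀ a c (b : ι ⊕ ι), ∑ x, matV' A B d (.inl a) x * matV' A B d x (.inr b) /
      matV' A B d x c = -2 * d * (matV' A B d (.inl a) (.inr b) /
        (matV' A B d (.inr b) c * matV' A B d (.inl a) c)) := by
    intro a c b
    rw [Fintype.sum_sum_type]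
    rcases c with c | c <;>
      simp only [matV'_inl_inl, matV'_inl_inr, matV'_inr_inl, matV'_inr_inr]
    · exact h.star_right hA hd0 a b c
    -- With `c` in the second half, the halves trade roles: `B` becomes `Bᵀ`, and `a` and `b` are
    -- exchanged.
    · have := h.transpose.star_right hA hd0 b a c
      simp only [Matrix.transpose_apply] at this
      rw [add_comm, mul_comm (blockSign b * blockSign c * _), ← this]
      congr 1 <;> refine Finset.sum_congr rfl fun x _ => ?_
      · rw [hA.apply (blockPos b) (blockPos x)]
        ring
      · rw [hA.apply (blockPos x) (blockPos a)]
        ring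
  intro a b c
  rcases a with a | a <;> rcases b with b | b
  · rw [Fintype.sum_sum_type]
    rcases c with c | c <;>
      simp only [matV'_inl_inl, matV'_inl_inr, matV'_inr_inl, matV'_inr_inr]
    · exact h.star_same hA hd0 a b c
    · exact h.star_left a b c
  · exact hlr a c b
  -- By symmetry of `V'` the relation is invariant under exchanging `a` and `b`.
  · have hs : ∀ x y, matV' A B d x y = matV' A B d y x := fun x y =>
      (matV'_isSymm hA).apply y x
    have := hlr b c a
    rw [mul_comm (matV' A B d (.inr a) c), hs (.inl b)] at this
    rw [← this]
    refine Finset.sum_congr rfl fun x _ => ?_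
    rw [hs (.inr a) x, hs x (.inl b), mul_comm]
  · rw [Fintype.sum_sum_type]
    rcases c with c | c <;>
      simp only [matV'_inl_inl, matV'_inl_inr, matV'_inr_inl, matV'_inr_inr]
    · rw [add_comm]
      exact h.transpose.star_left a b c
    · rw [add_comm]
      exact h.transpose.star_same hA hd0 a b c

end SpinModel

end JonesPair

theorem mainTheorem4 (n : ℕ) (d : ℂ) (hd : d ^ 2 = (n : ℂ))
    (A B : Matrix (Fin n) (Fin n) ℂ)
    (hAB : JonesPair.IsInvertibleJonesPair A B) (hA : A.IsSymm) :
    JonesPair.matV' A B d =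
        JonesPair.matD (Fin n) * JonesPair.matV A B d * JonesPair.matD (Fin n) ∧
      (JonesPair.matV' A B d).IsSymm ∧
      JonesPair.IsSpinModel (JonesPair.matV' A B d) (-2 * d) ∧
      ∃ h : JonesPair.nomura (JonesPair.matV' A B d) = JonesPair.nomura (JonesPair.matV A B d),
        ∀ (M : Matrix (JonesPair.Four (Fin n)) (JonesPair.Four (Fin n)) ℂ)
          (hM : M ∈ JonesPair.nomura (JonesPair.matV' A B d)),
          JonesPair.theta (JonesPair.matV' A B d) M hM =
            JonesPair.theta (JonesPair.matV A B d) M (h ▸ hM) := by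
  have hd' : d ^ 2 = (Fintype.card (Fin n) : ℂ) := by rw [hd, Fintype.card_fin]
  have hspin := hAB.matV'_isSpinModel hA hd'
  exact ⟨JonesPair.matV'_eq A B d, JonesPair.matV'_isSymm hA, hspin,
    JonesPair.nomura_matV' A B d, fun M hM =>
      JonesPair.theta_matV' hspin.typeII.schur M hM _⟩
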